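/- Let $\mathcal H$ be an infinite-dimensional complex Hilbert space, $\mathcal B(\mathcal H)$ the bounded linear operators on $\mathcal H$, $\mathcal H\otimes\mathcal H$ the Hilbert space tensor product, $I$ the identity operator on $\mathcal H$, and $S\in\mathcal B(\mathcal H\otimes\mathcal H)$ the swap operator, $S(x\otimes y)=y\otimes x$. The $W^*$-topology on the bounded operators on a Hilbert space is the coarsest topology for which $A\mapsto \operatorname{tr}(AT)$ is continuous for every trace class operator $T$. Let $\Psi:\mathcal B(\mathcal H)\to\mathcal B(\mathcal H\otimes\mathcal H)$ be a linear map that is continuous for the $W^*$-topologies. Suppose that $\Psi$ is covariant under unitary evolution, i.e. $\Psi(UXU^*)=(U\otimes U)\Psi(X)(U^*\otimes U^*)$ for all $X\in\mathcal B(\mathcal H)$ and all unitary $U\in\mathcal B(\mathcal H)$, and invariant under permutation of the copies, i.e. $S\Psi(X)S=\Psi(X)$ for all $X\in\mathcal B(\mathcal H)$. Then: (a) $\Psi(I)=I\otimes I$ if and only if $\Psi(X)=\tfrac12(I\otimes X+X\otimes I)$ for all $X\in\mathcal B(\mathcal H)$. (b) $\Psi(I)=S$ if and only if $\Psi(X)=\tfrac12[S(I\otimes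 X)+S(X\otimes I)]$ for all $X\in\mathcal B(\mathcal H)$. (c) $\|\Psi\|_{cb}=\|\Psi\|=\|\Psi(I)\|$ (in particular $\Psi$ is bounded and completely bounded). Here $\|\Psi\|=\sup\{\|\Psi(X)\|:\|X\|\le1\}$ and $\|\Psi\|_{cb}=\sup_{n\ge1}\|\Psi_n\|$, where $\Psi_n:M_n(\mathcal B(\mathcal H))\to M_n(\mathcal B(\mathcal H\otimes\mathcal H))$ applies $\Psi$ to each entry, $M_n(\mathcal B(\mathcal H))$ carries the operator norm on $\mathcal H^n$ (its $C^*$-norm), and similarly for $M_n(\mathcal B(\mathcal H\otimes\mathcal H))$. -/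

import Mathlib

open scoped TensorProduct InnerProductSpace ENNReal Topology

noncomputable section

namespace UnitaryCovariance

universe u

/-! ### Trace class operators and the weak* topology on `B(H)` -/

section WeakStar

variable (H : Type u) [NormedAddCommGroup H] [InnerProductSpace ℂ H] [CompleteSpace H]

/-- Index set of a fixed orthonormal (Hilbert) basis of `H`. -/
def basisIndex : Set H := (exists_hilbertBasis ℂ H).choose

/-- A fixed orthonormal (Hilbert) basis of `H`. Being trace class and the trace of a trace class
operator do not depend on which orthonormal basis is used. -/
def stdBasis : HilbertBasis (basisIndex H) ℂ H :=
  (exists_hilbertBasis ℂ H).choose_spec.choose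

variable {H}

/-- `T` is trace class: the sum of `⟨|T| e, e⟩` over an orthonormal basis is finite, where
`|T| = (T* T)^(1/2)`. The summands are nonnegative reals. -/
def IsTraceClass (T : H →L[ℂ] H) : Prop :=
  Summable fun i => (⟪stdBasis H i, CFC.abs T (stdBasis H i)⟫_ℂ).re

/-- The trace `∑ ⟨T e, e⟩` over an orthonormal basis; meaningful for trace class `T`. -/
def trace (T : H →L[ℂ] H) : ℂ := ∑' i, ⟪stdBasis H i, T (stdBasis H i)⟫_ℂ

variable (H)

/-- The `W*`-topology (weak* topology) on `B(H)`: the coarsest topology making every functional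
`A ↦ tr (A T)`, with `T` trace class, continuous. -/
abbrev weakStarTopology : TopologicalSpace (H →L[ℂ] H) :=
  ⨅ T : {T : H →L[ℂ] H // IsTraceClass T},
    TopologicalSpace.induced (fun A => trace (A * T.1)) inferInstance

end WeakStar

/-! ### The Hilbert space tensor square, tensor products of operators, and the swap -/

section Tensor

variable (H : Type u) [NormedAddCommGroup H] [InnerProductSpace ℂ H]

/-- The Hilbert space tensor product `H ⊗ H`: the completion of the algebraic tensor product for
the inner product with `⟨x ⊗ y, x' ⊗ y'⟩ = ⟨x, x'⟩ ⟨y, y'⟩`. -/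
abbrev TensorSq : Type u := UniformSpace.Completion (H ⊗[ℂ] H)

/-- The swap operator `S (x ⊗ y) = y ⊗ x`. -/
def swap : TensorSq H →L[ℂ] TensorSq H :=
  ((TensorProduct.commIsometry ℂ H H).toContinuousLinearEquiv :
    H ⊗[ℂ] H →L[ℂ] H ⊗[ℂ] H).completion

variable {H}

/-- The operator `A ⊗ B` on `H ⊗ H`, with `(A ⊗ B) (x ⊗ y) = A x ⊗ B y`. -/
def opTensor (A B : H →L[ℂ] H) : TensorSq H →L[ℂ] TensorSq H :=
  (TensorProduct.mapL A B).completion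

/-- Covariance under unitary evolution. -/
def IsUnitarilyCovariant [CompleteSpace H]
    (Ψ : (H →L[ℂ] H) →ₗ[ℂ] (TensorSq H →L[ℂ] TensorSq H)) : Prop :=
  ∀ U ∈ unitary (H →L[ℂ] H), ∀ X : H →L[ℂ] H,
    Ψ (U * X * star U) = opTensor U U * Ψ X * opTensor (star U) (star U)

/-- Invariance under permutation of the copies. -/
def IsPermutationInvariant
    (Ψ : (H →L[ℂ] H) →ₗ[ℂ] (TensorSq H →L[ℂ] TensorSq H)) : Prop :=
  ∀ X : H →L[ℂ] H, swap H * Ψ X * swap H = Ψ X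

end Tensor

/-! ### Operator norm and completely bounded norm -/

section Norms

/-- The norm `sup {‖f x‖ : ‖x‖ ≤ 1}` of a (linear) map `f`, as an extended nonnegative real
(`∞` exactly when `f` is unbounded). -/
def mapNorm {V W : Type*} [NormedAddCommGroup V] [NormedAddCommGroup W] (f : V → W) : ℝ≥0∞ :=
  ⨆ (x : V) (_ : ‖x‖ ≤ 1), ‖f x‖ₑ

variable {H K : Type*} [NormedAddCommGroup H] [InnerProductSpace ℂ H] [CompleteSpace H]
  [NormedAddCommGroup K] [InnerProductSpace ℂ K] [CompleteSpace K]

/-- The amplification `Φ_n : M_n(B(H)) → M_n(B(K))`, applying `Φ` to every entry. Here `M_n(B(H))`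
carries its C*-norm. -/
def amplification (n : ℕ) (Φ : (H →L[ℂ] H) →ₗ[ℂ] (K →L[ℂ] K)) :
    CStarMatrix (Fin n) (Fin n) (H →L[ℂ] H) →ₗ[ℂ] CStarMatrix (Fin n) (Fin n) (K →L[ℂ] K) :=
  CStarMatrix.mapₗ Φ

/-- The completely bounded norm `sup_{n ≥ 1} ‖Φ_n‖`, as an extended nonnegative real. -/
def cbNorm (Φ : (H →L[ℂ] H) →ₗ[ℂ] (K →L[ℂ] K)) : ℝ≥0∞ :=
  ⨆ (n : ℕ) (_ : 1 ≤ n), mapNorm (amplification n Φ)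

end Norms

end UnitaryCovariance

end

/-! Differentiating covariance along the unitaries `1 + c • P`, with `P` a projection and `1 + c` on
the unit circle, gives `Ψ [P, X] = [P ⊗ 1 + 1 ⊗ P, Ψ X]`. By linearity the same holds with any rank
one operator in place of `P`, so `Ψ` intertwines two Lie algebra actions and weights can be
compared.

For orthonormal `x, y, k` the vector `Ψ (|x⟩⟨y|) (y ⊗ k)` has the weight of `x ⊗ k`, hence equals `a
x ⊗ k + b k ⊗ x`. Subtracting `standardMap H a b` leaves an intertwining, swap-invariant `Φ` that
vanishes there. Commutators spread this to `Φ (|x⟩⟨y|) = 0` for all orthogonal pairs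
(`apply_rankOne_eq_zero`, `apply_rankOne_eq_zero_of_orthogonal`). Weak* continuity and infinite
dimension finish: what could survive is a trace, as for `X ↦ tr(X) 1` in finite dimension, and
`eq_zero_of_rankOne_orthogonal` excludes it.

Thus `Ψ X = Ψ 1 * ½ (X ⊗ 1 + 1 ⊗ X)`. Parts (a) and (b) can be read off, and (c) holds because the
second factor is an average of two *-homomorphisms. -/

noncomputable section

namespace UnitaryCovariance

open UniformSpace InnerProductSpace Filter

/-! ### Elementary tensors and operators on the tensor square -/

section TensorAPI

variable {H : Type*} [NormedAddCommGroup H] [InnerProductSpace ℂ H]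

/-- The elementary tensor `x ⊗ y` in the Hilbert space tensor square. -/
def tm (x y : H) : TensorSq H := ((x ⊗ₜ[ℂ] y : H ⊗[ℂ] H) : Completion (H ⊗[ℂ] H))

lemma tm_add_left (x x' y : H) : tm (x + x') y = tm x y + tm x' y := by
  rw [tm, TensorProduct.add_tmul, Completion.coe_add]; rfl

lemma tm_add_right (x y y' : H) : tm x (y + y') = tm x y + tm x y' := by
  rw [tm, TensorProduct.tmul_add, Completion.coe_add]; rfl

lemma tm_smul_left (c : ℂ) (x y : H) : tm (c • x) y = c • tm x y := by
  rw [tm, ← TensorProduct.smul_tmul', Completion.coe_smul]; rfl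

lemma tm_smul_right (c : ℂ) (x y : H) : tm x (c • y) = c • tm x y := by
  simp [tm, TensorProduct.tmul_smul, Completion.coe_smul]

@[simp] lemma tm_zero_left (y : H) : tm 0 y = 0 := by simp [tm]

@[simp] lemma tm_zero_right (x : H) : tm x 0 = 0 := by simp [tm]

@[simp] lemma inner_tm (a b c d : H) : ⟪tm a b, tm c d⟫_ℂ = ⟪a, c⟫_ℂ * ⟪b, d⟫_ℂ := by
  simp [tm, Completion.inner_coe]

@[simp] lemma opTensor_tm (A B : H →L[ℂ] H) (x y : H) :
    opTensor A B (tm x y) = tm (A x) (B y) := by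
  simp [opTensor, tm]

@[simp] lemma swap_tm (x y : H) : swap H (tm x y) = tm y x := by
  simp only [swap, tm, ContinuousLinearMap.completion_apply_coe]
  rfl

lemma ext_tm {E : Type*} [NormedAddCommGroup E] [NormedSpace ℂ E] {A B : TensorSq H →L[ℂ] E}
    (h : ∀ x y, A (tm x y) = B (tm x y)) : A = B := by
  ext z
  induction z using Completion.induction_on with
  | hp => exact isClosed_eq A.continuous B.continuous
  | ih z =>
    induction z using TensorProduct.induction_on with
    | zero => rw [Completion.coe_zero, map_zero, map_zero]
    | tmul x y => exact h x y
    | add z w hz hw => rw [Completion.coe_add, map_add, map_add, hz, hw]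

lemma eq_of_inner_tm {u v : TensorSq H} (h : ∀ x y, ⟪tm x y, u⟫_ℂ = ⟪tm x y, v⟫_ℂ) : u = v := by
  have : innerSL ℂ u = innerSL ℂ v := ext_tm fun x y => by
    rw [innerSL_apply_apply, innerSL_apply_apply, ← inner_conj_symm, h, inner_conj_symm]
  exact ext_inner_right ℂ fun w => congrArg (fun f => f w) this

lemma ext_inner_tm {A B : TensorSq H →L[ℂ] TensorSq H}
    (h : ∀ a b c d, ⟪tm a b, A (tm c d)⟫_ℂ = ⟪tm a b, B (tm c d)⟫_ℂ) : A = B :=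
  ext_tm fun c d => eq_of_inner_tm fun a b => h a b c d

lemma opTensor_add_left (A A' B : H →L[ℂ] H) :
    opTensor (A + A') B = opTensor A B + opTensor A' B :=
  ext_tm fun x y => by simp [tm_add_left]

lemma opTensor_add_right (A B B' : H →L[ℂ] H) :
    opTensor A (B + B') = opTensor A B + opTensor A B' :=
  ext_tm fun x y => by simp [tm_add_right]

lemma opTensor_smul_left (c : ℂ) (A B : H →L[ℂ] H) : opTensor (c • A) B = c • opTensor A B :=
  ext_tm fun x y => by simp [tm_smul_left]

lemma opTensor_smul_right (c : ℂ) (A B : H →L[ℂ] H) : opTensor A (c • B) = c • opTensor A B :=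
  ext_tm fun x y => by simp [tm_smul_right]

lemma opTensor_mul (A A' B B' : H →L[ℂ] H) :
    opTensor (A * A') (B * B') = opTensor A B * opTensor A' B' :=
  ext_tm fun x y => by simp

@[simp] lemma opTensor_one : opTensor (1 : H →L[ℂ] H) 1 = 1 := ext_tm fun x y => by simp

lemma star_opTensor [CompleteSpace H] (A B : H →L[ℂ] H) :
    star (opTensor A B) = opTensor (star A) (star B) := by
  refine ext_inner_tm fun a b c d => ?_
  simp [ContinuousLinearMap.star_eq_adjoint, ContinuousLinearMap.adjoint_inner_right]

/-- The derivation `A ⊗ 1 + 1 ⊗ A` associated with the operator `A`. -/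
def derivOp (A : H →L[ℂ] H) : TensorSq H →L[ℂ] TensorSq H := opTensor A 1 + opTensor 1 A

lemma derivOp_tm (A : H →L[ℂ] H) (x y : H) : derivOp A (tm x y) = tm (A x) y + tm x (A y) := by
  simp [derivOp]

lemma derivOp_add (A B : H →L[ℂ] H) : derivOp (A + B) = derivOp A + derivOp B := by
  simp only [derivOp, opTensor_add_left, opTensor_add_right]; abel

lemma derivOp_smul (c : ℂ) (A : H →L[ℂ] H) : derivOp (c • A) = c • derivOp A := by
  simp only [derivOp, opTensor_smul_left, opTensor_smul_right, smul_add]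

@[simp] lemma derivOp_one : derivOp (1 : H →L[ℂ] H) = (2 : ℂ) • 1 := by
  simp [derivOp, two_smul]

lemma derivOp_mul (A B : H →L[ℂ] H) :
    derivOp A * derivOp B = derivOp (A * B) + (opTensor A B + opTensor B A) := by
  refine ext_tm fun x y => ?_
  simp only [mul_apply_eq_comp, derivOp_tm, map_add, add_apply,
    opTensor_tm]
  abel

end TensorAPI

/-! ### Trace class operators and weak*-continuous functionals -/

section TraceAPI

variable {H : Type*} [NormedAddCommGroup H] [InnerProductSpace ℂ H]

lemma hasSum_norm_inner_sq {ι : Type*} (b : HilbertBasis ι ℂ H) (x : H) :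
    HasSum (fun i => ‖⟪b i, x⟫_ℂ‖ ^ 2) (‖x‖ ^ 2) := by
  have h := Complex.hasSum_re (b.hasSum_inner_mul_inner x x)
  have h2 : (⟪x, x⟫_ℂ).re = ‖x‖ ^ 2 := by
    rw [inner_self_eq_norm_sq_to_K]; norm_cast
  rw [h2] at h
  refine h.congr_fun fun i => ?_
  rw [← inner_conj_symm x (b i), mul_comm, Complex.mul_conj, Complex.normSq_eq_norm_sq]
  norm_cast

lemma summable_norm_comp_sq {ι : Type*} (b : HilbertBasis ι ℂ H) {A : H →L[ℂ] H}
    (B : H →L[ℂ] H) (hA : Summable fun i => ‖A (b i)‖ ^ 2) :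
    Summable fun i => ‖(B * A) (b i)‖ ^ 2 := by
  refine (hA.mul_left (‖B‖ ^ 2)).of_nonneg_of_le (fun i => by positivity) fun i => ?_
  rw [← mul_pow]
  gcongr
  exact B.le_opNorm _

lemma mul_rankOne (A : H →L[ℂ] H) (x y : H) : A * rankOne ℂ x y = rankOne ℂ (A x) y := by
  ext z; simp

variable [CompleteSpace H]

/-- The Hilbert–Schmidt sum is the double sum of squared matrix entries, and passing to the adjoint
transposes the indices. -/
lemma summable_norm_adjoint_sq {ι : Type*} (b : HilbertBasis ι ℂ H) {A : H →L[ℂ] H}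
    (hA : Summable fun i => ‖A (b i)‖ ^ 2) : Summable fun i => ‖(star A) (b i)‖ ^ 2 := by
  have key : ∀ B : H →L[ℂ] H, (Summable fun p : ι × ι => ‖⟪b p.2, B (b p.1)⟫_ℂ‖ ^ 2) ↔
      Summable fun i => ‖B (b i)‖ ^ 2 := fun B => by
    have h := summable_prod_of_nonneg (f := fun p : ι × ι => ‖⟪b p.2, B (b p.1)⟫_ℂ‖ ^ 2)
      fun p => sq_nonneg _
    have h1 : ∀ i, ∑' j, ‖⟪b j, B (b i)⟫_ℂ‖ ^ 2 = ‖B (b i)‖ ^ 2 := fun i =>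
      (hasSum_norm_inner_sq b _).tsum_eq
    simp only [h1] at h
    exact h.trans (and_iff_right fun i => (hasSum_norm_inner_sq b _).summable)
  rw [← key] at hA ⊢
  refine ((Equiv.prodComm ι ι).summable_iff.mpr hA).congr fun p => ?_
  simp only [Function.comp_apply, Equiv.prodComm_apply, Prod.fst_swap, Prod.snd_swap]
  rw [ContinuousLinearMap.star_eq_adjoint, ContinuousLinearMap.adjoint_inner_right,
    norm_inner_symm]

/-- Polar decomposition, without uniqueness of the partial isometry. -/
lemma exists_eq_mul_abs (T : H →L[ℂ] H) : ∃ V : H →L[ℂ] H, T = V * CFC.abs T := by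
  set s := CFC.abs T with hs
  have hsa : IsSelfAdjoint s := (CFC.abs_nonneg T).isSelfAdjoint
  have hnorm : ∀ x, ‖T x‖ = ‖s x‖ := fun x => by
    have h1 : star s * s = star T * T := by rw [hsa.star_eq, hs, CFC.abs_mul_abs]
    have h2 : ∀ R : H →L[ℂ] H, ⟪x, (star R * R) x⟫_ℂ = (‖R x‖ : ℂ) ^ 2 := fun R => by
      rw [mul_apply_eq_comp, ContinuousLinearMap.star_eq_adjoint,
        ContinuousLinearMap.adjoint_inner_right, inner_self_eq_norm_sq_to_K]; rfl
    have h3 := (h2 T).symm.trans ((h1 ▸ rfl : _ = _).trans (h2 s))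
    norm_cast at h3
    exact (sq_eq_sq₀ (norm_nonneg _) (norm_nonneg _)).mp h3
  set R : Submodule ℂ H := (LinearMap.range (s : H →ₗ[ℂ] H)).topologicalClosure
  have hmem : ∀ x, s x ∈ R := fun x => Submodule.le_topologicalClosure _ ⟨x, rfl⟩
  let e : H →ₗ[ℂ] R := (s : H →ₗ[ℂ] H).codRestrict R hmem
  have hdense : DenseRange e := by
    intro ⟨y, hy⟩
    rw [closure_subtype]
    convert hy using 1
    rw [← Set.range_comp]
    rfl
  have : CompleteSpace R := (Submodule.isClosed_topologicalClosure _).completeSpace_coe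
  -- By `hnorm`, `|T| x ↦ T x` is well defined and isometric on the range of `|T|`, so it extends to
  -- the closure `R`.
  let W : R →L[ℂ] H := (T : H →ₗ[ℂ] H).extendOfNorm e
  have hW : ∀ x, W (e x) = T x := fun x =>
    LinearMap.extendOfNorm_eq hdense ⟨1, fun x => by
      rw [one_mul]; exact (hnorm x).le⟩ x
  refine ⟨W ∘L R.orthogonalProjectionOnto, ?_⟩
  ext x
  have : R.orthogonalProjectionOnto (s x) = e x :=
    Submodule.orthogonalProjectionOnto_mem_subspace_eq_self (e x)
  simp [this, hW]

lemma IsTraceClass.summable_inner {T : H →L[ℂ] H} (hT : IsTraceClass T) (X : H →L[ℂ] H) :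
    Summable fun i => ⟪stdBasis H i, (X * T) (stdBasis H i)⟫_ℂ := by
  obtain ⟨V, hV⟩ := exists_eq_mul_abs T
  set r := CFC.sqrt (CFC.abs T) with hr
  have hrr : r * r = CFC.abs T := CFC.sqrt_mul_sqrt_self _ (CFC.abs_nonneg T)
  have hrs : star r = r := (CFC.sqrt_nonneg (CFC.abs T)).isSelfAdjoint.star_eq
  have h1 : Summable fun i => ‖r (stdBasis H i)‖ ^ 2 := by
    refine Summable.congr hT fun i => ?_
    rw [← hrr, mul_apply_eq_comp, ← ContinuousLinearMap.adjoint_inner_left,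
      ← ContinuousLinearMap.star_eq_adjoint, hrs, inner_self_eq_norm_sq_to_K]
    norm_cast
  have h2 : Summable fun i => ‖(star (X * V * r)) (stdBasis H i)‖ ^ 2 :=
    summable_norm_adjoint_sq _ (summable_norm_comp_sq _ _ h1)
  refine Summable.of_norm_bounded (h1.add h2) fun i => ?_
  -- With `r = |T|^(1/2)`, this writes `X * T` as a product of two Hilbert–Schmidt operators;
  -- Cauchy–Schwarz then bounds its diagonal entries.
  have h3 : X * T = (X * V * r) * r := by
    rw [mul_assoc (X * V), hrr, mul_assoc, ← hV]
  rw [h3, mul_apply_eq_comp, ← ContinuousLinearMap.adjoint_inner_left,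
    ← ContinuousLinearMap.star_eq_adjoint]
  refine (norm_inner_le_norm _ _).trans ?_
  nlinarith [sq_nonneg (‖(star (X * V * r)) (stdBasis H i)‖ - ‖r (stdBasis H i)‖),
    sq_nonneg (‖(star (X * V * r)) (stdBasis H i)‖ + ‖r (stdBasis H i)‖)]

lemma abs_rankOne (x y : H) (hy : y ≠ 0) :
    CFC.abs (rankOne ℂ x y) = ((‖x‖ / ‖y‖ : ℝ) : ℂ) • rankOne ℂ y y := by
  have hy' : (‖y‖ : ℂ) ≠ 0 := by exact_mod_cast norm_ne_zero_iff.mpr hy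
  refine CFC.sqrt_unique ?_ ?_
  · ext z
    simp only [ContinuousLinearMap.star_eq_adjoint, adjoint_rankOne, mul_apply_eq_comp,
      rankOne_apply, smul_apply, map_smul, inner_self_eq_norm_sq_to_K, smul_smul]
    congr 1
    push_cast
    simp only [Complex.coe_algebraMap]
    field_simp
  · rw [ContinuousLinearMap.nonneg_iff_isPositive]
    refine (isPositive_rankOne_self y).smul_of_nonneg ?_
    have : 0 ≤ ‖x‖ / ‖y‖ := by positivity
    exact_mod_cast this

lemma isTraceClass_rankOne (x y : H) : IsTraceClass (rankOne ℂ x y) := by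
  by_cases hy : y = 0
  · simp [IsTraceClass, hy]
  · rw [IsTraceClass, abs_rankOne x y hy]
    refine ((hasSum_norm_inner_sq (stdBasis H) y).summable.mul_left (‖x‖ / ‖y‖)).congr fun i => ?_
    simp only [smul_apply, rankOne_apply, inner_smul_right, Complex.re_ofReal_mul]
    congr 1
    rw [← inner_conj_symm y, mul_comm, Complex.mul_conj, Complex.normSq_eq_norm_sq]
    norm_cast

lemma hasSum_inner_rankOne (x y : H) :
    HasSum (fun i => ⟪stdBasis H i, rankOne ℂ x y (stdBasis H i)⟫_ℂ) ⟪y, x⟫_ℂ := by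
  simpa [inner_smul_right] using (stdBasis H).hasSum_inner_mul_inner y x

lemma rankOne_mul (A : H →L[ℂ] H) (x y : H) : rankOne ℂ x y * A = rankOne ℂ x (star A y) := by
  ext z; simp [ContinuousLinearMap.star_eq_adjoint, ContinuousLinearMap.adjoint_inner_left]

lemma trace_mul_rankOne (A : H →L[ℂ] H) (x y : H) :
    trace (A * rankOne ℂ x y) = ⟪y, A x⟫_ℂ := by
  rw [mul_rankOne, trace, (hasSum_inner_rankOne _ _).tsum_eq]

lemma continuous_inner_weakStar (x y : H) :
    Continuous[weakStarTopology H, inferInstance] fun A : H →L[ℂ] H => ⟪y, A x⟫_ℂ := by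
  rw [show (fun A : H →L[ℂ] H => ⟪y, A x⟫_ℂ) = fun A => trace (A * rankOne ℂ x y) from
    funext fun A => (trace_mul_rankOne A x y).symm]
  refine continuous_iff_le_induced.mpr ?_
  exact iInf_le (fun T : {T : H →L[ℂ] H // IsTraceClass T} =>
    TopologicalSpace.induced (fun A => trace (A * T.1)) inferInstance)
    ⟨rankOne ℂ x y, isTraceClass_rankOne x y⟩

lemma tendsto_weakStar {ι : Type*} {l : Filter ι} {A : ι → H →L[ℂ] H} {A₀ : H →L[ℂ] H}
    (h : ∀ T, IsTraceClass T → Tendsto (fun i => trace (A i * T)) l (𝓝 (trace (A₀ * T)))) :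
    Tendsto A l (@nhds _ (weakStarTopology H) A₀) := by
  rw [nhds_iInf, tendsto_iInf]
  intro T
  rw [nhds_induced, tendsto_comap_iff]
  exact h T.1 T.2

/-- A weak*-continuous functional is determined by its values on rank one operators whose range
is spanned by a basis vector. -/
lemma eq_zero_of_rankOne (g : (H →L[ℂ] H) →ₗ[ℂ] ℂ)
    (hg : Continuous[weakStarTopology H, inferInstance] g)
    (h : ∀ i y, g (rankOne ℂ (stdBasis H i) y) = 0) (X : H →L[ℂ] H) : g X = 0 := by
  -- `A F` is `Q X` with `Q` the projection onto the span of the basis vectors in `F`; its traces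
  -- against `T` are the partial sums of `trace (X * T)`.
  let A : Finset (basisIndex H) → H →L[ℂ] H :=
    fun F => ∑ i ∈ F, rankOne ℂ (stdBasis H i) (star X (stdBasis H i))
  have hA : Tendsto A atTop (@nhds _ (weakStarTopology H) X) := by
    refine tendsto_weakStar fun T hT => (hT.summable_inner X).hasSum.congr fun F => ?_
    have h1 := hasSum_sum (s := F) fun i _ =>
      hasSum_inner_rankOne (stdBasis H i) (star (X * T) (stdBasis H i))
    simp only [A, Finset.sum_mul, trace, rankOne_mul, ← mul_apply_eq_comp, ← star_mul, sum_apply,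
      inner_sum]
    rw [h1.tsum_eq]
    refine Finset.sum_congr rfl fun i _ => ?_
    rw [ContinuousLinearMap.star_eq_adjoint, ContinuousLinearMap.adjoint_inner_left]
  have h1 := (@Continuous.tendsto _ _ (weakStarTopology H) _ g hg X).comp hA
  have h2 : g ∘ A = fun _ => 0 := by
    funext F
    simp [A, h]
  rw [h2] at h1
  exact tendsto_nhds_unique h1 tendsto_const_nhds

lemma infinite_basisIndex (hH : ¬ FiniteDimensional ℂ H) : Infinite (basisIndex H) := by
  by_contra hfin
  rw [not_infinite_iff_finite] at hfin
  have := Fintype.ofFinite (basisIndex H)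
  exact hH (stdBasis H).toOrthonormalBasis.toBasis.finiteDimensional_of_finite

/-- In infinite dimension, a weak*-continuous functional is determined by its values on the
operators `|x⟩⟨y|` with `x` and `y` orthogonal. -/
lemma eq_zero_of_rankOne_orthogonal (hH : ¬ FiniteDimensional ℂ H) (g : (H →L[ℂ] H) →ₗ[ℂ] ℂ)
    (hg : Continuous[weakStarTopology H, inferInstance] g)
    (h : ∀ x y, ⟪x, y⟫_ℂ = 0 → g (rankOne ℂ x y) = 0) (X : H →L[ℂ] H) : g X = 0 := by
  have := infinite_basisIndex hH
  have hon : ∀ i j, i ≠ j → ⟪stdBasis H i, stdBasis H j⟫_ℂ = 0 := fun i j hij =>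
    (stdBasis H).orthonormal.2 hij
  have hone : ∀ i, ⟪stdBasis H i, stdBasis H i⟫_ℂ = 1 := fun i =>
    inner_self_eq_one_of_norm_eq_one ((stdBasis H).orthonormal.1 i)
  have hconst : ∀ i j, g (rankOne ℂ (stdBasis H i) (stdBasis H i)) =
      g (rankOne ℂ (stdBasis H j) (stdBasis H j)) := fun i j => by
    rcases eq_or_ne i j with rfl | hij
    · rfl
    -- `e i + e j` and `e i - e j` are orthogonal; expanding leaves only the difference of the two
    -- diagonal values.
    have h1 := h (stdBasis H i + stdBasis H j) (stdBasis H i - stdBasis H j) (by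
      simp only [inner_add_left, inner_sub_right, hone, hon i j hij, hon j i hij.symm]; ring)
    simp only [map_add, map_sub, add_apply, h _ _ (hon i j hij), h _ _ (hon j i hij.symm)] at h1
    linear_combination h1
  have hdiag : ∀ i, g (rankOne ℂ (stdBasis H i) (stdBasis H i)) = 0 := fun i => by
    -- Diagonal entries of a trace class operator are summable, so they tend to zero. As the index
    -- set is infinite, the common diagonal value must be zero.
    have h1 : Tendsto (fun j => rankOne ℂ (stdBasis H j) (stdBasis H j)) cofinite
        (@nhds _ (weakStarTopology H) 0) := by
      refine tendsto_weakStar fun T hT => ?_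
      have h2 : trace ((0 : H →L[ℂ] H) * T) = 0 := by simp [trace]
      rw [h2]
      refine (hT.summable_inner 1).tendsto_cofinite_zero.congr fun j => ?_
      rw [rankOne_mul, trace, (hasSum_inner_rankOne _ _).tsum_eq,
        ContinuousLinearMap.star_eq_adjoint, ContinuousLinearMap.adjoint_inner_left, one_mul]
    have h2 := (@Continuous.tendsto _ _ (weakStarTopology H) _ g hg 0).comp h1
    rw [map_zero] at h2
    exact tendsto_nhds_unique (tendsto_const_nhds.congr fun j => hconst i j) h2
  refine eq_zero_of_rankOne g hg (fun i y => ?_) X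
  set e := stdBasis H i
  have h1 : g (rankOne ℂ e (y - ⟪e, y⟫_ℂ • e)) = 0 := h _ _ (by
    rw [inner_sub_right, inner_smul_right, hone]; ring)
  rw [map_sub, map_smulₛₗ, map_sub, map_smul, hdiag, smul_zero, sub_zero] at h1
  exact h1

end TraceAPI

/-! ### From unitary covariance to commutator identities -/

section Lie

variable {H : Type*} [NormedAddCommGroup H] [InnerProductSpace ℂ H]

/-- The operators `A` for which `Ψ` intertwines the commutator with `A` and the commutator with
`A ⊗ 1 + 1 ⊗ A`. -/
def intertwined (Ψ : (H →L[ℂ] H) →ₗ[ℂ] (TensorSq H →L[ℂ] TensorSq H)) :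
    Submodule ℂ (H →L[ℂ] H) where
  carrier := {A | ∀ X, Ψ (A * X - X * A) = derivOp A * Ψ X - Ψ X * derivOp A}
  zero_mem' X := by
    have h : derivOp (0 : H →L[ℂ] H) = 0 := ext_tm fun x y => by simp [derivOp_tm]
    simp [h]
  add_mem' {A B} hA hB X := by
    have h : (A + B) * X - X * (A + B) = (A * X - X * A) + (B * X - X * B) := by noncomm_ring
    rw [h, map_add, hA X, hB X, derivOp_add]
    noncomm_ring
  smul_mem' c A hA X := by
    have h : (c • A) * X - X * (c • A) = c • (A * X - X * A) := by
      rw [smul_mul_assoc, mul_smul_comm, smul_sub]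
    rw [h, map_smul, hA X, derivOp_smul, smul_mul_assoc, mul_smul_comm, smul_sub]

lemma opTensor_one_add_smul (c : ℂ) (P : H →L[ℂ] H) :
    opTensor (1 + c • P) (1 + c • P) = 1 + c • derivOp P + (c * c) • opTensor P P := by
  simp only [opTensor_add_left, opTensor_add_right, opTensor_smul_left, opTensor_smul_right,
    opTensor_one, derivOp, smul_add, smul_smul]
  abel

/-- First order comparison of coefficients in an identity between trigonometric polynomials with
values in a normed algebra. -/
lemma sub_eq_commutator_of_forall_exp {B : Type*} [NormedRing B] [NormedAlgebra ℂ B]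
    (b₁ b₂ b₃ D R Y : B) (h : ∀ c d : ℂ, c + d + c * d = 0 → star c = d →
      Y + c • b₁ + d • b₂ + (c * d) • b₃ =
        (1 + c • D + (c * c) • R) * Y * (1 + d • D + (d * d) • R)) :
    b₁ - b₂ = D * Y - Y * D := by
  -- Here `1 + c t = exp (i t)` and `d` is the conjugate of `c`; the constraint in `h` says that `1
  -- + c` is unimodular.
  let c : ℝ → ℂ := fun t => Complex.exp (t * Complex.I) - 1
  let d : ℝ → ℂ := fun t => Complex.exp (-(t * Complex.I)) - 1
  have hcd : ∀ t, c t + d t + c t * d t = 0 := fun t => by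
    have : Complex.exp (t * Complex.I) * Complex.exp (-(t * Complex.I)) = 1 := by
      rw [← Complex.exp_add, add_neg_cancel, Complex.exp_zero]
    simp only [c, d]
    linear_combination this
  have hstar : ∀ t, star (c t) = d t := fun t => by
    simp only [c, d, star_sub, star_one, RCLike.star_def, ← Complex.exp_conj]
    simp
  have hc : HasDerivAt c Complex.I 0 := by
    have := ((Complex.ofRealCLM.hasDerivAt (x := (0 : ℝ))).mul_const Complex.I).cexp.sub_const 1
    simpa [c] using this
  have hd : HasDerivAt d (-Complex.I) 0 := by
    have := ((Complex.ofRealCLM.hasDerivAt (x := (0 : ℝ))).mul_const Complex.I).neg.cexp.sub_const 1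
    simpa [d] using this
  have hc0 : c 0 = 0 := by simp [c]
  have hd0 : d 0 = 0 := by simp [d]
  have hL := (((hc.smul_const b₁).const_add Y).add
    (hd.smul_const b₂)).add ((hc.mul hd).smul_const b₃)
  have hRt := (((((hc.smul_const D).const_add 1).add ((hc.mul hc).smul_const R))).mul_const
    Y).mul (((hd.smul_const D).const_add 1).add ((hd.mul hd).smul_const R))
  have h1 := hL.unique (hRt.congr_of_eventuallyEq
    (Filter.Eventually.of_forall fun t => h (c t) (d t) (hcd t) (hstar t)))
  simp only [hc0, hd0, Pi.add_apply, Pi.mul_apply, zero_smul, mul_zero, zero_mul, add_zero, mul_one,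
    one_mul] at h1
  -- At `0` the derivatives of `c` and `d` are `I` and `-I`, and all quadratic terms drop out; the
  -- factor `-I` cancels the common `I`.
  have h2 := congrArg (fun z => (-Complex.I) • z) h1
  simpa [smul_smul, sub_eq_add_neg] using h2

variable [CompleteSpace H] {Ψ : (H →L[ℂ] H) →ₗ[ℂ] (TensorSq H →L[ℂ] TensorSq H)}

/-- For the unitary `U = 1 + c • P`, both `U X U*` and `U ⊗ U` are polynomials in `c` and its
conjugate, so the first-order terms of covariance can be compared. -/
lemma IsUnitarilyCovariant.mem_intertwined_of_isStarProjection (hΨ : IsUnitarilyCovariant Ψ)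
    {P : H →L[ℂ] H} (hP : IsStarProjection P) : P ∈ intertwined Ψ := by
  intro X
  have hPP : P * P = P := hP.isIdempotentElem
  have hPs : star P = P := hP.isSelfAdjoint
  rw [map_sub]
  refine sub_eq_commutator_of_forall_exp _ _ (Ψ (P * X * P)) _ (opTensor P P) _
    fun c d hcd hstar => ?_
  have hU : star (1 + c • P) = 1 + d • P := by
    rw [star_add, star_one, star_smul, hPs, hstar]
  have hUmem : 1 + c • P ∈ unitary (H →L[ℂ] H) := by
    have h1 : ∀ a b : ℂ, (1 + a • P) * (1 + b • P) = 1 + (a + b + a * b) • P := fun a b => by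
      simp only [add_mul, mul_add, one_mul, mul_one, smul_mul_assoc, mul_smul_comm, hPP]
      module
    rw [Unitary.mem_iff, hU, h1, h1, hcd, show d + c + d * c = 0 by linear_combination hcd]
    simp
  rw [← opTensor_one_add_smul, ← opTensor_one_add_smul, ← hU, ← hΨ _ hUmem, hU]
  simp only [add_mul, mul_add, one_mul, mul_one, smul_mul_assoc, mul_smul_comm, map_add, map_smul]
  module

lemma rankOne_polarization (u v : H) : rankOne ℂ u v = (1 / 4 : ℂ) •
    (rankOne ℂ (u + v) (u + v) - rankOne ℂ (u - v) (u - v) +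
      Complex.I • rankOne ℂ (u + Complex.I • v) (u + Complex.I • v) -
      Complex.I • rankOne ℂ (u - Complex.I • v) (u - Complex.I • v)) := by
  simp only [map_add, map_sub, map_smulₛₗ, add_apply, sub_apply, smul_apply, smul_add, smul_sub,
    smul_smul, Complex.conj_I, RingHom.id_apply]
  simp only [mul_neg, neg_mul, Complex.I_mul_I]
  module

/-- Polarization reduces to `|w⟩⟨w|`, a multiple of a projection. -/
lemma IsUnitarilyCovariant.rankOne_mem_intertwined (hΨ : IsUnitarilyCovariant Ψ) (u v : H) :
    rankOne ℂ u v ∈ intertwined Ψ := by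
  have h : ∀ w : H, rankOne ℂ w w ∈ intertwined Ψ := fun w => by
    rcases eq_or_ne w 0 with rfl | hw
    · simp
    have hw' : (‖w‖ : ℂ) ≠ 0 := by exact_mod_cast norm_ne_zero_iff.mpr hw
    have h1 : rankOne ℂ w w = ((‖w‖ : ℂ) * ‖w‖) •
        rankOne ℂ ((‖w‖ : ℂ)⁻¹ • w) ((‖w‖ : ℂ)⁻¹ • w) := by
      simp only [map_smulₛₗ, smul_apply, smul_smul, RingHom.id_apply, map_inv₀, Complex.conj_ofReal]
      field_simp
      simp
    rw [h1]
    refine Submodule.smul_mem _ _ (hΨ.mem_intertwined_of_isStarProjection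
      (isStarProjection_rankOne_self ?_))
    rw [norm_smul, norm_inv, Complex.norm_real, norm_norm, inv_mul_cancel₀ (norm_ne_zero_iff.mpr hw)]
  rw [rankOne_polarization]
  exact Submodule.smul_mem _ _ (sub_mem (add_mem (sub_mem (h _) (h _))
    (Submodule.smul_mem _ _ (h _))) (Submodule.smul_mem _ _ (h _)))

end Lie

/-! ### Weight arguments and the classification of covariant maps -/

section Structure

variable {H : Type*} [NormedAddCommGroup H] [InnerProductSpace ℂ H]

/-- The map `X ↦ (a + b S) (X ⊗ 1 + 1 ⊗ X)`. -/
def standardMap (H : Type*) [NormedAddCommGroup H] [InnerProductSpace ℂ H] (a b : ℂ) :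
    (H →L[ℂ] H) →ₗ[ℂ] (TensorSq H →L[ℂ] TensorSq H) where
  toFun X := (a • 1 + b • swap H) * derivOp X
  map_add' X Y := by rw [derivOp_add, mul_add]
  map_smul' c X := by rw [derivOp_smul, mul_smul_comm]; rfl

lemma standardMap_apply (a b : ℂ) (X : H →L[ℂ] H) :
    standardMap H a b X = (a • 1 + b • swap H) * derivOp X := rfl

lemma standardMap_tm (a b : ℂ) (X : H →L[ℂ] H) (x y : H) :
    standardMap H a b X (tm x y) =
      a • (tm (X x) y + tm x (X y)) + b • (tm y (X x) + tm (X y) x) := by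
  simp [standardMap_apply, derivOp_tm]

lemma swap_mul_derivOp (A : H →L[ℂ] H) : swap H * derivOp A = derivOp A * swap H :=
  ext_tm fun x y => by simp [derivOp_tm, add_comm]

lemma mem_intertwined_standardMap (a b : ℂ) (A : H →L[ℂ] H) :
    A ∈ intertwined (standardMap H a b) := fun X => by
  have h1 : derivOp A * (a • 1 + b • swap H) = (a • 1 + b • swap H) * derivOp A := by
    simp only [mul_add, add_mul, mul_smul_comm, smul_mul_assoc, mul_one, one_mul, swap_mul_derivOp]
  have h2 : derivOp (A * X - X * A) = derivOp A * derivOp X - derivOp X * derivOp A := by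
    have : derivOp (A * X) = derivOp (A * X - X * A) + derivOp (X * A) := by
      rw [← derivOp_add, sub_add_cancel]
    rw [derivOp_mul, derivOp_mul, this]
    abel
  rw [standardMap_apply, standardMap_apply, h2, mul_sub, ← mul_assoc, ← mul_assoc,
    ← mul_assoc (derivOp A), h1]

lemma isPermutationInvariant_standardMap (a b : ℂ) :
    IsPermutationInvariant (standardMap H a b) := fun X => by
  refine ext_tm fun x y => ?_
  simp only [mul_apply_eq_comp, swap_tm, standardMap_tm, map_add, map_smul]
  rw [add_comm (tm x (X y)), add_comm (tm (X y) x)]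

/-- An idempotent `P` gives `P ⊗ 1 + 1 ⊗ P` only the possible eigenvalues `0, 1, 2`. -/
lemma eq_zero_of_derivOp_apply_eq_neg {P : H →L[ℂ] H} (hP : P * P = P) {w : TensorSq H}
    (hw : derivOp P w = -w) : w = 0 := by
  have h1 : opTensor P P * derivOp P = (2 : ℂ) • opTensor P P := by
    rw [derivOp, mul_add, ← opTensor_mul, ← opTensor_mul, hP, mul_one, two_smul]
  have h2 : opTensor P P w = 0 := by
    have := congrArg (fun A => A w) h1
    simp only [mul_apply_eq_comp, hw, map_neg, smul_apply] at this
    have h3 : (3 : ℂ) • opTensor P P w = 0 := by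
      rw [show (3 : ℂ) = 2 + 1 by norm_num, add_smul, ← this]; simp
    exact (smul_eq_zero.mp h3).resolve_left (by norm_num)
  have h3 := congrArg (fun A => A w) (derivOp_mul P P)
  simp only [mul_apply_eq_comp, hw, map_neg, neg_neg, add_apply, hP, h2, add_zero] at h3
  have h4 : (2 : ℂ) • w = 0 := by rw [two_smul]; nth_rewrite 1 [h3]; simp
  exact (smul_eq_zero.mp h4).resolve_left (by norm_num)

lemma opTensor_rankOne (u u' v v' : H) :
    opTensor (rankOne ℂ u u') (rankOne ℂ v v') = rankOne ℂ (tm u v) (tm u' v') :=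
  ext_tm fun x y => by simp [tm_smul_left, tm_smul_right, smul_smul, mul_comm]

/-- For orthogonal `x, k` the product of the two derivations is `|x⟩⟨x| ⊗ |k⟩⟨k| + |k⟩⟨k| ⊗ |x⟩⟨x|`.
It fixes `w`, so `w` lies in its range. -/
lemma exists_eq_of_derivOp_apply_eq {x k : H} (hxk : ⟪x, k⟫_ℂ = 0) {w : TensorSq H}
    (hx : derivOp (rankOne ℂ x x) w = w) (hk : derivOp (rankOne ℂ k k) w = w) :
    ∃ a b : ℂ, w = a • tm x k + b • tm k x := by
  have h := congrArg (fun A => A w) (derivOp_mul (rankOne ℂ x x) (rankOne ℂ k k))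
  have h0 : rankOne ℂ x x * rankOne ℂ k k = 0 := by
    ext z; simp [hxk]
  have h1 : derivOp (0 : H →L[ℂ] H) = 0 := ext_tm fun x y => by simp [derivOp_tm]
  simp only [mul_apply_eq_comp, hk, hx, h0, h1, add_apply, opTensor_rankOne, rankOne_apply,
    zero_add] at h
  exact ⟨_, _, h⟩

variable {Φ : (H →L[ℂ] H) →ₗ[ℂ] (TensorSq H →L[ℂ] TensorSq H)}

lemma intertwined_rankOne (hΦ : ∀ u v : H, rankOne ℂ u v ∈ intertwined Φ) (u v x y : H) :
    ⟪v, x⟫_ℂ • Φ (rankOne ℂ u y) - ⟪y, u⟫_ℂ • Φ (rankOne ℂ x v) =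
      derivOp (rankOne ℂ u v) * Φ (rankOne ℂ x y) -
        Φ (rankOne ℂ x y) * derivOp (rankOne ℂ u v) := by
  have h : ∀ u v x y : H, rankOne ℂ u v * rankOne ℂ x y = ⟪v, x⟫_ℂ • rankOne ℂ u y :=
    fun u v x y => by ext z; simp [smul_smul, mul_comm]
  have h1 := hΦ u v (rankOne ℂ x y)
  rwa [h, h, map_sub, map_smul, map_smul] at h1

lemma intertwined_rankOne_apply (hΦ : ∀ u v : H, rankOne ℂ u v ∈ intertwined Φ) (u v x y : H)
    (w : TensorSq H) : derivOp (rankOne ℂ u v) (Φ (rankOne ℂ x y) w) =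
      Φ (rankOne ℂ x y) (derivOp (rankOne ℂ u v) w) + ⟪v, x⟫_ℂ • Φ (rankOne ℂ u y) w -
        ⟪y, u⟫_ℂ • Φ (rankOne ℂ x v) w := by
  have h := congrArg (fun A => A w) (intertwined_rankOne hΦ u v x y)
  simp only [sub_apply, smul_apply, mul_apply_eq_comp] at h
  rw [add_sub_assoc, h]
  abel

/-- `|x⟩⟨y|` trades one unit of `y`-weight for one of `x`-weight, so the image of `y ⊗ k` has weight
one in both `x` and `k`. -/
lemma exists_apply_rankOne_tm {x y k : H} (hx : ‖x‖ = 1) (hk : ‖k‖ = 1)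
    (hxy : ⟪x, y⟫_ℂ = 0) (hxk : ⟪x, k⟫_ℂ = 0) (hyk : ⟪y, k⟫_ℂ = 0)
    (hΦ : ∀ u v : H, rankOne ℂ u v ∈ intertwined Φ) :
    ∃ a b : ℂ, Φ (rankOne ℂ x y) (tm y k) = a • tm x k + b • tm k x := by
  have hyx := inner_eq_zero_symm.mp hxy
  have hkx := inner_eq_zero_symm.mp hxk
  have hky := inner_eq_zero_symm.mp hyk
  refine exists_eq_of_derivOp_apply_eq hxk ?_ ?_
  · rw [intertwined_rankOne_apply hΦ]
    simp [derivOp_tm, hx, hxy, hyx, hxk]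
  · rw [intertwined_rankOne_apply hΦ]
    simp [derivOp_tm, hk, hkx, hky, hyk]

lemma apply_rankOne_eq_zero {x y k : H} (hx : ‖x‖ = 1) (hy : ‖y‖ = 1) (hk : ‖k‖ = 1)
    (hxy : ⟪x, y⟫_ℂ = 0) (hxk : ⟪x, k⟫_ℂ = 0) (hyk : ⟪y, k⟫_ℂ = 0)
    (hΦ : ∀ u v : H, rankOne ℂ u v ∈ intertwined Φ)
    (h1 : Φ (rankOne ℂ x y) (tm y k) = 0) (h2 : Φ (rankOne ℂ x y) (tm k y) = 0) :
    Φ (rankOne ℂ x y) = 0 := by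
  have hyx := inner_eq_zero_symm.mp hxy
  have hkx := inner_eq_zero_symm.mp hxk
  have hky := inner_eq_zero_symm.mp hyk
  set C := Φ (rankOne ℂ x y) with hC
  -- The image would have `y`-weight `-1`, which does not occur.
  have h00 : ∀ l m, ⟪y, l⟫_ℂ = 0 → ⟪y, m⟫_ℂ = 0 → C (tm l m) = 0 := fun l m hl hm => by
    refine eq_zero_of_derivOp_apply_eq_neg (P := rankOne ℂ y y) (by ext z; simp [hy]) ?_
    rw [hC, intertwined_rankOne_apply hΦ]
    simp [derivOp_tm, hl, hm, hy, hyx]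
  -- `|u⟩⟨k|` commutes with `|x⟩⟨y|`, and its derivation carries `y ⊗ k` to `y ⊗ u`.
  have h10 : ∀ u, ⟪y, u⟫_ℂ = 0 → C (tm y u) = 0 := fun u hu => by
    have h := intertwined_rankOne_apply hΦ u k x y (tm y k)
    simpa [← hC, h1, hkx, hu, derivOp_tm, hky, hk] using h.symm
  have h01 : ∀ u, ⟪y, u⟫_ℂ = 0 → C (tm u y) = 0 := fun u hu => by
    have h := intertwined_rankOne_apply hΦ u k x y (tm k y)
    simpa [← hC, h2, hkx, hu, derivOp_tm, hky, hk] using h.symm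
  have h11 : C (tm y y) = 0 := by
    obtain ⟨p, q, hpq⟩ : ∃ p q : ℂ, C (tm y y) = p • tm x y + q • tm y x := by
      refine exists_eq_of_derivOp_apply_eq hxy ?_ ?_
      · rw [hC, intertwined_rankOne_apply hΦ]
        simp [derivOp_tm, hx, hxy, hyx]
      · rw [hC, intertwined_rankOne_apply hΦ]
        simp [derivOp_tm, hy, hyx]
    -- The derivation of `|k⟩⟨y|` sends `y ⊗ y` to `k ⊗ y + y ⊗ k`, which `C` kills, and sends the
    -- right side of `hpq` to `p x ⊗ k + q k ⊗ x`; hence `p = q = 0`.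
    have h := intertwined_rankOne_apply hΦ k y x y (tm y y)
    simp only [← hC, hpq, derivOp_tm, rankOne_apply] at h
    simp [derivOp_tm, hyx, hyk, hy, h1, h2] at h
    have hp : ⟪tm x k, p • tm x k + q • tm k x⟫_ℂ = 0 := by rw [h, inner_zero_right]
    have hq : ⟪tm k x, p • tm x k + q • tm k x⟫_ℂ = 0 := by rw [h, inner_zero_right]
    rw [inner_add_right, inner_smul_right, inner_smul_right, inner_tm, inner_tm] at hp hq
    simp only [inner_self_eq_one_of_norm_eq_one hx, inner_self_eq_one_of_norm_eq_one hk, hxk, hkx,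
      mul_zero, mul_one, add_zero, zero_add] at hp hq
    simp [hpq, hp, hq]
  have hdec : ∀ l : H, ∃ (c : ℂ) (l' : H), l = c • y + l' ∧ ⟪y, l'⟫_ℂ = 0 := fun l =>
    ⟨⟪y, l⟫_ℂ, l - ⟪y, l⟫_ℂ • y, by simp, by simp [hy]⟩
  refine ext_tm fun l m => ?_
  obtain ⟨c, l', rfl, hl⟩ := hdec l
  obtain ⟨d, m', rfl, hm⟩ := hdec m
  simp [tm_add_left, tm_add_right, tm_smul_left, tm_smul_right, h00 _ _ hl hm, h10 _ hm, h01 _ hl,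
    h11]

lemma exists_unit_orthogonal (hH : ¬ FiniteDimensional ℂ H) (u v : H) :
    ∃ k : H, ‖k‖ = 1 ∧ ⟪u, k⟫_ℂ = 0 ∧ ⟪v, k⟫_ℂ = 0 := by
  let K : Submodule ℂ H := Submodule.span ℂ {u, v}
  have : FiniteDimensional ℂ K := FiniteDimensional.span_of_finite ℂ (by simp)
  have hK : Kᗮ ≠ ⊥ := fun h => by
    rw [Submodule.orthogonal_eq_bot_iff] at h
    rw [h] at this
    exact hH (Module.Finite.equiv (Submodule.topEquiv (R := ℂ) (M := H)))
  obtain ⟨w, hw, hw0⟩ := Submodule.exists_mem_ne_zero_of_ne_bot hK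
  have hmem : ∀ z ∈ K, ⟪z, w⟫_ℂ = 0 := fun z hz => Submodule.inner_right_of_mem_orthogonal hz hw
  refine ⟨(‖w‖⁻¹ : ℂ) • w, ?_, ?_, ?_⟩
  · exact norm_smul_inv_norm hw0
  · rw [inner_smul_right, hmem u (Submodule.subset_span (by simp)), mul_zero]
  · rw [inner_smul_right, hmem v (Submodule.subset_span (by simp)), mul_zero]

/-- Commutators with rank one operators replace one vector of the pair at a time; the auxiliary `k`,
orthogonal to `y` and `y₀`, links the given pair to `x₀, y₀`. -/
lemma apply_rankOne_eq_zero_of_orthogonal (hH : ¬ FiniteDimensional ℂ H)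
    (hΦ : ∀ u v : H, rankOne ℂ u v ∈ intertwined Φ) {x₀ y₀ : H} (hx : ‖x₀‖ = 1)
    (hy : ‖y₀‖ = 1) (h0 : Φ (rankOne ℂ x₀ y₀) = 0) {x y : H}
    (hxy : ⟪x, y⟫_ℂ = 0) : Φ (rankOne ℂ x y) = 0 := by
  have hne : ∀ z : H, ‖z‖ = 1 → z ≠ 0 := fun z hz h => by simp [h] at hz
  have h1 : ∀ u, ⟪y₀, u⟫_ℂ = 0 → Φ (rankOne ℂ u y₀) = 0 := fun u hu => by
    simpa [h0, hne _ hx, hu] using intertwined_rankOne hΦ u x₀ x₀ y₀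
  have h2 : ∀ u v, ⟪y₀, u⟫_ℂ = 0 → ⟪v, u⟫_ℂ = 0 → Φ (rankOne ℂ u v) = 0 := fun u v hu hv => by
    simpa [h1 u hu, hne _ hy, hv] using intertwined_rankOne hΦ y₀ v u y₀
  obtain ⟨k, hk, hyk, hk₀⟩ := exists_unit_orthogonal hH y y₀
  simpa [h2 k y hk₀ hyk, hne _ hk, inner_eq_zero_symm.mp hxy] using intertwined_rankOne hΦ x k k y

/-- A weak*-continuous, unitarily covariant and permutation invariant map is
`X ↦ (a + b S) (X ⊗ 1 + 1 ⊗ X)` for some scalars `a` and `b`. -/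
theorem exists_eq_standardMap [CompleteSpace H] (hH : ¬ FiniteDimensional ℂ H)
    {Ψ : (H →L[ℂ] H) →ₗ[ℂ] (TensorSq H →L[ℂ] TensorSq H)}
    (hcont : Continuous[weakStarTopology H, weakStarTopology (TensorSq H)] Ψ)
    (hcov : IsUnitarilyCovariant Ψ) (hperm : IsPermutationInvariant Ψ) :
    ∃ a b : ℂ, Ψ = standardMap H a b := by
  obtain ⟨x, hx, -, -⟩ := exists_unit_orthogonal hH 0 0
  obtain ⟨y, hy, hxy, -⟩ := exists_unit_orthogonal hH x x
  obtain ⟨k, hk, hxk, hyk⟩ := exists_unit_orthogonal hH x y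
  obtain ⟨a, b, hab⟩ :=
    exists_apply_rankOne_tm hx hk hxy hxk hyk hcov.rankOne_mem_intertwined
  refine ⟨a, b, ?_⟩
  set Φ := Ψ - standardMap H a b with hΦdef
  have hΦ : ∀ u v : H, rankOne ℂ u v ∈ intertwined Φ := fun u v X => by
    have h1 := hcov.rankOne_mem_intertwined u v X
    have h2 := mem_intertwined_standardMap a b (rankOne ℂ u v) X
    rw [hΦdef, LinearMap.sub_apply, LinearMap.sub_apply, h1, h2]
    noncomm_ring
  have hΦperm : ∀ X u v, Φ X (tm u v) = swap H (Φ X (tm v u)) := fun X u v => by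
    have h : swap H * Φ X * swap H = Φ X := by
      rw [hΦdef, LinearMap.sub_apply, mul_sub, sub_mul, hperm,
        isPermutationInvariant_standardMap a b X]
    nth_rewrite 1 [← h]
    simp
  have h1 : Φ (rankOne ℂ x y) (tm y k) = 0 := by
    rw [hΦdef, LinearMap.sub_apply, sub_apply, hab, standardMap_tm]
    simp [hy, hyk]
  have h0 := apply_rankOne_eq_zero hx hy hk hxy hxk hyk hΦ h1 (by rw [hΦperm, h1, map_zero])
  suffices h : ∀ X, Φ X = 0 from
    LinearMap.ext fun X => sub_eq_zero.mp (h X)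
  intro X
  refine ext_inner_tm fun c d c' d' => ?_
  rw [zero_apply, inner_zero_right]
  -- Each matrix coefficient of `Φ` is a weak*-continuous functional vanishing on orthogonal rank
  -- one operators.
  let g : (H →L[ℂ] H) →ₗ[ℂ] ℂ :=
    { toFun X := ⟪tm c d, Φ X (tm c' d')⟫_ℂ
      map_add' X Y := by rw [map_add, add_apply, inner_add_right]
      map_smul' r X := by rw [map_smul, smul_apply, inner_smul_right]; rfl }
  refine eq_zero_of_rankOne_orthogonal hH g ?_ (fun u v huv => ?_) X
  · have hΨc : Continuous[weakStarTopology H, inferInstance]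
        fun X => ⟪tm c d, Ψ X (tm c' d')⟫_ℂ :=
      @Continuous.comp _ _ _ (weakStarTopology H) (weakStarTopology (TensorSq H)) _ _ _
        (continuous_inner_weakStar (tm c' d') (tm c d)) hcont
    have e := fun u v : H => continuous_inner_weakStar u v
    let : TopologicalSpace (H →L[ℂ] H) := weakStarTopology H
    have h : ⇑g = fun X => ⟪tm c d, Ψ X (tm c' d')⟫_ℂ -
        (a * (⟪c, X c'⟫_ℂ * ⟪d, d'⟫_ℂ + ⟪c, c'⟫_ℂ * ⟪d, X d'⟫_ℂ) +
          b * (⟪c, d'⟫_ℂ * ⟪d, X c'⟫_ℂ + ⟪c, X d'⟫_ℂ * ⟪d, c'⟫_ℂ)) := by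
      funext X
      simp only [g, hΦdef, LinearMap.coe_mk, AddHom.coe_mk, LinearMap.sub_apply, sub_apply,
        standardMap_tm, inner_sub_right, inner_add_right, inner_smul_right, inner_tm]
    rw [h]
    exact Continuous.sub hΨc (((((e c' c).mul_const _).add ((e d' d).const_mul _)).const_mul a).add
      ((((e c' d).const_mul _).add ((e d' c).mul_const _)).const_mul b))
  · simp [g, apply_rankOne_eq_zero_of_orthogonal hH hΦ hx hy h0 huv]

end Structure

/-! ### Completely bounded norm estimates -/

section CompleteBoundedness

variable {A : Type*} [CStarAlgebra A]

/-- The diagonal embedding of a C*-algebra in its matrix algebra. -/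
def diagonalHom (n : ℕ) : A →⋆ₙₐ[ℂ] CStarMatrix (Fin n) (Fin n) A where
  toFun a := CStarMatrix.ofMatrix (Matrix.diagonal fun _ => a)
  map_smul' c a := by
    ext i j
    rcases eq_or_ne i j with rfl | h <;> simp [CStarMatrix.ofMatrix_apply, *]
  map_zero' := by ext i j; simp [CStarMatrix.ofMatrix_apply]
  map_add' a b := by
    ext i j
    rcases eq_or_ne i j with rfl | h <;> simp [CStarMatrix.ofMatrix_apply, *]
  map_mul' a b := by
    ext i j
    rw [CStarMatrix.mul_apply]
    rcases eq_or_ne i j with rfl | h <;>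
      simp [CStarMatrix.ofMatrix_apply, Matrix.diagonal_apply, *]
  map_star' a := by
    ext i j
    rw [CStarMatrix.star_apply]
    rcases eq_or_ne i j with rfl | h <;> simp [CStarMatrix.ofMatrix_apply, *, Ne.symm]

lemma diagonalHom_apply (n : ℕ) (a : A) (i j : Fin n) :
    diagonalHom n a i j = if i = j then a else 0 := Matrix.diagonal_apply _ _ _

variable [PartialOrder A] [StarOrderedRing A] in
lemma norm_diagonalHom_le (n : ℕ) (a : A) : ‖diagonalHom n a‖ ≤ ‖a‖ :=
  NonUnitalStarAlgHom.norm_apply_le _ a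

variable {H K : Type*} [NormedAddCommGroup H] [InnerProductSpace ℂ H] [CompleteSpace H]
  [NormedAddCommGroup K] [InnerProductSpace ℂ K] [CompleteSpace K]

lemma mapNorm_le_cbNorm (Φ : (H →L[ℂ] H) →ₗ[ℂ] (K →L[ℂ] K)) : mapNorm Φ ≤ cbNorm Φ := by
  refine iSup₂_le fun X hX => ?_
  refine le_trans ?_ (le_iSup₂_of_le 1 le_rfl
    (le_iSup₂_of_le (diagonalHom 1 X) ((norm_diagonalHom_le 1 X).trans hX) le_rfl))
  rw [enorm_le_iff_norm_le]
  have h := CStarMatrix.norm_entry_le_norm (M := amplification 1 Φ (diagonalHom 1 X))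
    (i := 0) (j := 0)
  simpa [amplification, diagonalHom_apply] using h

/-- Amplified *-homomorphisms are contractive, hence so is their average; multiplication by `Z`
amplifies to multiplication by a diagonal matrix of norm at most `‖Z‖`. -/
lemma cbNorm_le_of_forall_eq (Φ : (H →L[ℂ] H) →ₗ[ℂ] (K →L[ℂ] K)) (Z : K →L[ℂ] K)
    (π₁ π₂ : (H →L[ℂ] H) →⋆ₙₐ[ℂ] (K →L[ℂ] K))
    (h : ∀ X, Φ X = Z * ((1 / 2 : ℂ) • (π₁ X + π₂ X))) : cbNorm Φ ≤ ‖Z‖ₑ := by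
  refine iSup₂_le fun n _ => iSup₂_le fun M hM => ?_
  have hM' : amplification n Φ M = diagonalHom n Z *
      ((1 / 2 : ℂ) • (CStarMatrix.mapₙₐ π₁ M + CStarMatrix.mapₙₐ π₂ M)) := by
    ext1 i j
    rw [CStarMatrix.mul_apply]
    simp [amplification, diagonalHom_apply, h]
  rw [hM', enorm_le_iff_norm_le]
  have h1 := (NonUnitalStarAlgHom.norm_apply_le (CStarMatrix.mapₙₐ (n := Fin n) π₁) M).trans hM
  have h2 := (NonUnitalStarAlgHom.norm_apply_le (CStarMatrix.mapₙₐ (n := Fin n) π₂) M).trans hM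
  refine (norm_mul_le _ _).trans ?_
  have h3 : ‖(1 / 2 : ℂ) • (CStarMatrix.mapₙₐ π₁ M + CStarMatrix.mapₙₐ π₂ M)‖ ≤ 1 := by
    rw [norm_smul, show ‖(1 / 2 : ℂ)‖ = 1 / 2 by norm_num]
    have h4 := norm_add_le (CStarMatrix.mapₙₐ π₁ M) (CStarMatrix.mapₙₐ π₂ M)
    linarith
  calc _ ≤ ‖Z‖ * 1 := mul_le_mul (norm_diagonalHom_le n Z) h3 (norm_nonneg _) (norm_nonneg _)
    _ = ‖Z‖ := mul_one _

end CompleteBoundedness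

/-! ### The two representations on the tensor square -/

section Embeddings

variable (H : Type*) [NormedAddCommGroup H] [InnerProductSpace ℂ H] [CompleteSpace H]

/-- The representation `X ↦ X ⊗ 1`. -/
def leftHom : (H →L[ℂ] H) →⋆ₙₐ[ℂ] (TensorSq H →L[ℂ] TensorSq H) where
  toFun X := opTensor X 1
  map_smul' c X := opTensor_smul_left c X 1
  map_zero' := ext_tm fun x y => by simp
  map_add' X Y := opTensor_add_left X Y 1
  map_mul' X Y := by rw [← opTensor_mul, mul_one]
  map_star' X := by rw [star_opTensor, star_one]

/-- The representation `X ↦ 1 ⊗ X`. -/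
def rightHom : (H →L[ℂ] H) →⋆ₙₐ[ℂ] (TensorSq H →L[ℂ] TensorSq H) where
  toFun X := opTensor 1 X
  map_smul' c X := opTensor_smul_right c 1 X
  map_zero' := ext_tm fun x y => by simp
  map_add' X Y := opTensor_add_right 1 X Y
  map_mul' X Y := by rw [← opTensor_mul, mul_one]
  map_star' X := by rw [star_opTensor, star_one]

end Embeddings

/-! ### Recovering the map from its value at the identity -/

section Main

variable {H : Type*} [NormedAddCommGroup H] [InnerProductSpace ℂ H]

/-- The derivation of `1` is `2`, so the value at `1` is `2 (a + b S)`. -/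
lemma standardMap_eq (a b : ℂ) (X : H →L[ℂ] H) : standardMap H a b X =
    standardMap H a b 1 * ((1 / 2 : ℂ) • (opTensor X 1 + opTensor 1 X)) := by
  rw [standardMap_apply, standardMap_apply, derivOp_one, mul_smul_comm, mul_smul_comm,
    smul_mul_assoc, mul_one, smul_smul, derivOp]
  norm_num

lemma norm_one_le : ‖(1 : H →L[ℂ] H)‖ ≤ 1 := ContinuousLinearMap.norm_id_le

end Main

end UnitaryCovariance

end

theorem corollary12 {H : Type*} [NormedAddCommGroup H] [InnerProductSpace ℂ H] [CompleteSpace H]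
    (hH : ¬ FiniteDimensional ℂ H)
    (Ψ : (H →L[ℂ] H) →ₗ[ℂ]
      (UnitaryCovariance.TensorSq H →L[ℂ] UnitaryCovariance.TensorSq H))
    (hcont : Continuous[UnitaryCovariance.weakStarTopology H,
      UnitaryCovariance.weakStarTopology (UnitaryCovariance.TensorSq H)] Ψ)
    (hcov : UnitaryCovariance.IsUnitarilyCovariant Ψ)
    (hperm : UnitaryCovariance.IsPermutationInvariant Ψ) :
    (Ψ 1 = 1 ↔
      ∀ X : H →L[ℂ] H, Ψ X =
        (1 / 2 : ℂ) • (UnitaryCovariance.opTensor 1 X + UnitaryCovariance.opTensor X 1)) ∧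
    (Ψ 1 = UnitaryCovariance.swap H ↔
      ∀ X : H →L[ℂ] H, Ψ X =
        (1 / 2 : ℂ) • (UnitaryCovariance.swap H * UnitaryCovariance.opTensor 1 X +
          UnitaryCovariance.swap H * UnitaryCovariance.opTensor X 1)) ∧
    UnitaryCovariance.cbNorm Ψ = UnitaryCovariance.mapNorm Ψ ∧
    UnitaryCovariance.mapNorm Ψ = ‖Ψ 1‖ₑ := by
  open UnitaryCovariance in
  obtain ⟨a, b, rfl⟩ := exists_eq_standardMap hH hcont hcov hperm
  have hX := standardMap_eq (H := H) a b
  refine ⟨⟨fun h X => ?_, fun h => ?_⟩, ⟨fun h X => ?_, fun h => ?_⟩, ?_⟩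
  · rw [hX, h, one_mul, add_comm]
  · rw [h, opTensor_one, ← two_smul ℂ, smul_smul]
    norm_num
  · rw [hX, h, mul_smul_comm, mul_add, add_comm]
  · rw [h, opTensor_one, mul_one, ← two_smul ℂ, smul_smul]
    norm_num
  -- The cycle `‖Ψ 1‖ ≤ ‖Ψ‖ ≤ ‖Ψ‖_cb ≤ ‖Ψ 1‖` forces equality throughout.
  · have h1 : ‖standardMap H a b 1‖ₑ ≤ mapNorm (standardMap H a b) :=
      le_iSup₂_of_le 1 norm_one_le le_rfl
    have h2 := mapNorm_le_cbNorm (standardMap H a b)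
    have h3 := cbNorm_le_of_forall_eq (standardMap H a b) _ (leftHom H) (rightHom H) hX
    exact ⟨le_antisymm (h3.trans h1) h2, le_antisymm (h2.trans h3) h1⟩
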